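/- **Theorem 2.9.** Let $n\ge 2$ be even and let $G=SD_{8n}=\langle a,b\mid a^{4n}=b^2=1,\ bab=a^{2n-1}\rangle$, regarded as a permutation group on the $4n$ residues modulo $4n$ through $a\mapsto (t\mapsto t+1)$, $b\mapsto (t\mapsto (2n-1)t)$. Let $V$ be an $m$-dimensional complex inner product space. For a character $\chi$ of $G$ let $V^{4n}_\chi(G)$ be the image of the operator $\frac{\chi(1)}{|G|}\sum_{\sigma\in G}\chi(\sigma)P_\sigma$ on $V^{\otimes 4n}$, where $P_\sigma(\otimes_t v_t)=\otimes_t v_{\sigma^{-1}(t)}$. Put $C^\dagger_{even}=\{2,4,\dots,2n-2\}$ and $C^\dagger_{odd}=\{1,3,\dots,n-1\}\cup\{2n+1,2n+3,\dots,3n-1\}$, and let $\overline{C^\dagger_{odd}}$ be the set of remainders of $s(2n-1)$ modulo $4n$ for $s\in C^\dagger_{odd}$. Let $\chi_0,\chi_1,\chi_2,\chi_3$ be the linear characters of $G$ with $(\chi_j(a),\chi_j(b))=(1,1),(1,-1),(-1,1),(-1,-1)$, respectively. With $\omega=e^{i\pi/2n}$, let $\rho^h$ be the representation of $G$ on $\mathbb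 C^2$ with $\rho^h(a)=\mathrm{diag}(\omega^h,\omega^{(2n-1)h})$ and $\rho^h(b)=\begin{pmatrix}0&1\\1&0\end{pmatrix}$; let $\varsigma_h$ be its character for $h\in C^\dagger_{even}$, and let $\psi_{h'}$ be the character of $\rho^{h'}$ for $h'\in C^\dagger_{odd}$. Then $$\dim V^{4n}_{\chi_0}(G)=\frac1{8n}\Big[2nm^n+2nm^{2n+1}+\sum_{k=0}^{4n-1}m^{\gcd(4n,k)}\Big],$$ $$\dim V^{4n}_{\chi_1}(G)=\frac1{8n}\Big[-2nm^n-2nm^{2n+1}+\sum_{k=0}^{4n-1}m^{\gcd(4n,k)}\Big],$$ $$\dim V^{4n}_{\chi_2}(G)=\frac1{8n}\Big[m^{4n}+m^{2n}+2\sum_{k\in C^\dagger_{even}}m^{\gcd(4n,k)}-\sum_{k\in C^\dagger_{odd}\cup\overline{C^\dagger_{odd}}}m^{\gcd(4n,k)}+2nm^{2n+1}-2nm^n\Big],$$ $$\dim V^{4n}_{\chi_3}(G)=\frac1{8n}\Big[m^{4n}+m^{2n}+2\sum_{k\in C^\dagger_{even}}m^{\gcd(4n,k)}-\sum_{k\in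 C^\dagger_{odd}\cup\overline{C^\dagger_{odd}}}m^{\gcd(4n,k)}-2nm^{2n+1}+2nm^n\Big],$$ and, for every $h\in C^\dagger_{even}$ and every $h'\in C^\dagger_{odd}$, $$\dim V^{4n}_{\varsigma_h}(G)=\frac1{2n}\sum_{k=0}^{4n-1}m^{\gcd(4n,k)}\cos\Big(\frac{hk\pi}{2n}\Big),$$ $$\dim V^{4n}_{\psi_{h'}}(G)=\frac1{4n}\Big[2m^{4n}-2m^{2n}+4\sum_{k\in C^\dagger_{even}}m^{\gcd(4n,k)}\cos\Big(\frac{h'k\pi}{2n}\Big)\Big].$$ -/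

import Mathlib

open scoped TensorProduct

noncomputable section

namespace SemiDihedral

/-! ### Symmetry classes of tensors -/

/-- The operator `T(G, χ) = (χ(1) / |G|) ∑_{g ∈ G} χ(g) P_g` on `⨂_{i ∈ ι} V`, for a finite group `G`
acting on the index set `ι` through `T : G →* Equiv.Perm ι`. Here `P_g` is `reindex` along `T g`:
it sends `⨂ i, v i` to `⨂ i, v ((T g)⁻¹ i)`. -/
def symmetrizer {G ι : Type*} [Group G] [Fintype G] (T : G →* Equiv.Perm ι) (χ : G → ℂ)
    (V : Type*) [AddCommGroup V] [Module ℂ V] :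
    (⨂[ℂ] _ : ι, V) →ₗ[ℂ] (⨂[ℂ] _ : ι, V) :=
  (χ 1 / (Fintype.card G : ℂ)) •
    ∑ g : G, χ g • (PiTensorProduct.reindex ℂ (fun _ : ι => V) (T g)).toLinearMap

/-- The symmetry class of tensors associated with `G` and `χ`: the image of `T(G, χ)`. -/
def symmetryClass {G ι : Type*} [Group G] [Fintype G] (T : G →* Equiv.Perm ι) (χ : G → ℂ)
    (V : Type*) [AddCommGroup V] [Module ℂ V] : Submodule ℂ (⨂[ℂ] _ : ι, V) :=
  LinearMap.range (symmetrizer T χ V)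

/-! ### The semi-dihedral group of order `8n` -/

/-- The two generators of the semi-dihedral group. -/
inductive Gen
  | a
  | b

/-- The relators of `⟨a, b ∣ a ^ (4n) = b ^ 2 = 1, b a b = a ^ (2n - 1)⟩`. -/
def rels (n : ℕ) : Set (FreeGroup Gen) :=
  {FreeGroup.of Gen.a ^ (4 * n), FreeGroup.of Gen.b ^ 2,
    FreeGroup.of Gen.b * FreeGroup.of Gen.a * FreeGroup.of Gen.b *
      (FreeGroup.of Gen.a ^ (2 * n - 1))⁻¹}

/-- The semi-dihedral group `SD_{8n} = ⟨a, b ∣ a ^ (4n) = b ^ 2 = 1, b a b = a ^ (2n - 1)⟩`. -/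
abbrev SD (n : ℕ) : Type := PresentedGroup (rels n)

/-- The homomorphism out of `SD_{8n}` determined by images of `a` and `b` satisfying the
relations. -/
def lift {H : Type*} [Group H] (n : ℕ) (x y : H) (h₁ : x ^ (4 * n) = 1) (h₂ : y ^ 2 = 1)
    (h₃ : y * x * y = x ^ (2 * n - 1)) : SD n →* H :=
  PresentedGroup.toGroup (rels := rels n) (f := fun g => Gen.casesOn g x y) (by
    intro r hr
    simp only [rels, Set.mem_insert_iff, Set.mem_singleton_iff] at hr
    rcases hr with rfl | rfl | rfl
    · simpa using h₁
    · simpa using h₂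
    · simpa [mul_inv_eq_one] using h₃)

section Finiteness

variable (n : ℕ)

theorem a_pow : (PresentedGroup.of Gen.a : SD n) ^ (4 * n) = 1 :=
  PresentedGroup.one_of_mem (rels := rels n) (by simp [rels])

theorem b_sq : (PresentedGroup.of Gen.b : SD n) ^ 2 = 1 :=
  PresentedGroup.one_of_mem (rels := rels n) (by simp [rels])

theorem b_a_b : (PresentedGroup.of Gen.b : SD n) * PresentedGroup.of Gen.a * PresentedGroup.of Gen.b
    = PresentedGroup.of Gen.a ^ (2 * n - 1) :=
  PresentedGroup.mk_eq_mk_of_mul_inv_mem (rels := rels n)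
    (x := FreeGroup.of Gen.b * FreeGroup.of Gen.a * FreeGroup.of Gen.b)
    (y := FreeGroup.of Gen.a ^ (2 * n - 1)) (by simp [rels])

instance [NeZero n] : Finite (SD n) := by
  set a : SD n := PresentedGroup.of Gen.a with ha
  set b : SD n := PresentedGroup.of Gen.b with hb
  have hn : 0 < 4 * n := by have := NeZero.pos n; omega
  have h1 : a ^ (4 * n) = 1 := a_pow n
  have h2 : b ^ 2 = 1 := b_sq n
  have hbb : b * b = 1 := by rw [← sq, h2]
  have h3 : b * a * b = a ^ (2 * n - 1) := b_a_b n
  have hbinv : b⁻¹ = b := inv_eq_of_mul_eq_one_left hbb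
  have hba : ∀ k : ℤ, b * a ^ k * b = a ^ (((2 * n - 1 : ℕ) : ℤ) * k) := by
    intro k
    have : b * a ^ k * b⁻¹ = (b * a * b⁻¹) ^ k := (conj_zpow).symm
    rw [hbinv, h3] at this
    rw [this, zpow_mul, zpow_natCast]
  have hfa : (Subgroup.zpowers a : Set (SD n)).Finite :=
    (isOfFinOrder_iff_pow_eq_one.2 ⟨4 * n, hn, h1⟩).finite_zpowers
  have hfb : (Subgroup.zpowers b : Set (SD n)).Finite :=
    (isOfFinOrder_iff_pow_eq_one.2 ⟨2, by norm_num, h2⟩).finite_zpowers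
  have key : ∀ g : SD n, (∃ k : ℤ, g = a ^ k) ∨ (∃ k : ℤ, g = b * a ^ k) := by
    intro g
    have hg : g ∈ Subgroup.closure (Set.range (PresentedGroup.of (rels := rels n))) := by
      rw [PresentedGroup.closure_range_of]; trivial
    induction hg using Subgroup.closure_induction with
    | mem x hx =>
      obtain ⟨i, rfl⟩ := hx
      cases i with
      | a => exact Or.inl ⟨1, by simp [ha]⟩
      | b => exact Or.inr ⟨0, by simp [hb]⟩
    | one => exact Or.inl ⟨0, by simp⟩
    | mul x y _ _ hx hy =>
      have hab : ∀ k : ℤ, a ^ k * b = b * a ^ (((2 * n - 1 : ℕ) : ℤ) * k) := by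
        intro k
        rw [← hba k, ← mul_assoc, ← mul_assoc, hbb, one_mul]
      rcases hx with ⟨k, rfl⟩ | ⟨k, rfl⟩ <;> rcases hy with ⟨l, rfl⟩ | ⟨l, rfl⟩
      · exact Or.inl ⟨k + l, by rw [zpow_add]⟩
      · exact Or.inr ⟨((2 * n - 1 : ℕ) : ℤ) * k + l, by
          rw [← mul_assoc, hab, mul_assoc, zpow_add]⟩
      · exact Or.inr ⟨k + l, by rw [zpow_add, mul_assoc]⟩
      · exact Or.inl ⟨((2 * n - 1 : ℕ) : ℤ) * k + l, by
          rw [← mul_assoc, hba, zpow_add]⟩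
    | inv x _ hx =>
      rcases hx with ⟨k, rfl⟩ | ⟨k, rfl⟩
      · exact Or.inl ⟨-k, by simp⟩
      · refine Or.inr ⟨((2 * n - 1 : ℕ) : ℤ) * (-k), ?_⟩
        rw [← hba (-k), ← mul_assoc, ← mul_assoc, hbb, one_mul, mul_inv_rev, hbinv, zpow_neg]
  have hfin : ((Subgroup.zpowers a : Set (SD n)) ∪
      (fun x => b * x) '' (Subgroup.zpowers a : Set (SD n))).Finite := hfa.union (hfa.image _)
  refine Set.finite_univ_iff.1 (hfin.subset ?_)
  intro g _
  rcases key g with ⟨k, rfl⟩ | ⟨k, rfl⟩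
  · exact Or.inl ⟨k, rfl⟩
  · exact Or.inr ⟨a ^ k, ⟨k, rfl⟩, rfl⟩

instance [NeZero n] : Fintype (SD n) := Fintype.ofFinite _

end Finiteness

/-! ### The action on `4n` points -/

theorem two_mul_sub_one_sq (n : ℕ) : ((2 * n - 1 : ZMod (4 * n))) * (2 * n - 1) = 1 := by
  have h : (4 * n : ZMod (4 * n)) = 0 := by exact_mod_cast ZMod.natCast_self (4 * n)
  linear_combination ((n : ZMod (4 * n)) - 1) * h

/-- The permutation `t ↦ t + 1` of the residues modulo `4n`. -/
def permA (n : ℕ) : Equiv.Perm (ZMod (4 * n)) := Equiv.addRight 1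

/-- The permutation `t ↦ (2n - 1) t` of the residues modulo `4n`. -/
def permB (n : ℕ) : Equiv.Perm (ZMod (4 * n)) where
  toFun t := (2 * n - 1) * t
  invFun t := (2 * n - 1) * t
  left_inv t := by simp only [← mul_assoc, two_mul_sub_one_sq, one_mul]
  right_inv t := by simp only [← mul_assoc, two_mul_sub_one_sq, one_mul]

theorem permA_pow (n k : ℕ) (t : ZMod (4 * n)) : (permA n ^ k) t = t + k := by
  simp [permA]

/-- The homomorphism `SD_{8n} → S_{4n}` with `a ↦ (t ↦ t + 1)` and `b ↦ (t ↦ (2n - 1) t)`, where the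
`4n` points are the residues modulo `4n`. -/
def toPerm (n : ℕ) [NeZero n] : SD n →* Equiv.Perm (ZMod (4 * n)) :=
  lift n (permA n) (permB n)
    (by
      ext1 t
      rw [permA_pow, ZMod.natCast_self]; simp)
    (by
      ext1 t
      rw [sq, Equiv.Perm.mul_apply]
      exact (permB n).left_inv t)
    (by
      ext1 t
      rw [permA_pow, Equiv.Perm.mul_apply, Equiv.Perm.mul_apply]
      have h1 : 1 ≤ 2 * n := by have := NeZero.pos n; omega
      simp only [permA, permB, Equiv.coe_fn_mk, Equiv.coe_addRight]
      push_cast [Nat.cast_sub h1]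
      linear_combination t * two_mul_sub_one_sq n)

/-! ### Characters -/

theorem sign_relation (n : ℕ) [NeZero n] (x y : ℂˣ) (hx : x ^ 2 = 1) (hy : y ^ 2 = 1) :
    y * x * y = x ^ (2 * n - 1) := by
  obtain ⟨k, rfl⟩ : ∃ k, n = k + 1 := Nat.exists_eq_succ_of_ne_zero (NeZero.ne n)
  have h : 2 * (k + 1) - 1 = 2 * k + 1 := by omega
  rw [h, pow_succ, pow_mul, hx, one_pow, one_mul, mul_right_comm, ← sq, hy, one_mul]

/-- The linear character of `SD_{8n}` with `a ↦ x`, `b ↦ y`, where `x, y ∈ {1, -1}`. -/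
def linearChar (n : ℕ) [NeZero n] (x y : ℂˣ) (hx : x ^ 2 = 1) (hy : y ^ 2 = 1) : SD n →* ℂˣ :=
  lift n x y (by rw [show 4 * n = 2 * (2 * n) by ring, pow_mul, hx, one_pow]) hy
    (sign_relation n x y hx hy)

/-- `χ₀(a) = 1`, `χ₀(b) = 1`. -/
def chi0 (n : ℕ) [NeZero n] (g : SD n) : ℂ := linearChar n 1 1 (by simp) (by simp) g

/-- `χ₁(a) = 1`, `χ₁(b) = -1`. -/
def chi1 (n : ℕ) [NeZero n] (g : SD n) : ℂ := linearChar n 1 (-1) (by simp) (by simp) g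

/-- `χ₂(a) = -1`, `χ₂(b) = 1`. -/
def chi2 (n : ℕ) [NeZero n] (g : SD n) : ℂ := linearChar n (-1) 1 (by simp) (by simp) g

/-- `χ₃(a) = -1`, `χ₃(b) = -1`. -/
def chi3 (n : ℕ) [NeZero n] (g : SD n) : ℂ := linearChar n (-1) (-1) (by simp) (by simp) g

/-- `ω = exp (iπ / (2n))`. -/
def omega (n : ℕ) : ℂ := Complex.exp (Complex.I * Real.pi / (2 * n))

theorem omega_ne_zero (n : ℕ) : omega n ≠ 0 := Complex.exp_ne_zero _

theorem omega_pow (n : ℕ) [NeZero n] : omega n ^ (4 * n) = 1 := by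
  have hn : (n : ℂ) ≠ 0 := by exact_mod_cast NeZero.ne n
  rw [omega, ← Complex.exp_nat_mul, ← Complex.exp_two_pi_mul_I]
  congr 1
  push_cast
  field_simp
  ring

/-- The matrix `diag (ω ^ h, ω ^ ((2n - 1) h))`. -/
def matA (n h : ℕ) : GL (Fin 2) ℂ :=
  Matrix.GeneralLinearGroup.mkOfDetNeZero
    !![omega n ^ h, 0; 0, omega n ^ ((2 * n - 1) * h)]
    (by simp [Matrix.det_fin_two, omega_ne_zero])

/-- The matrix exchanging the two coordinates. -/
def matB : GL (Fin 2) ℂ :=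
  Matrix.GeneralLinearGroup.mkOfDetNeZero !![0, 1; 1, 0] (by simp [Matrix.det_fin_two])

theorem coe_matA_pow (n h k : ℕ) : ((matA n h ^ k : GL (Fin 2) ℂ) : Matrix (Fin 2) (Fin 2) ℂ) =
    !![omega n ^ (h * k), 0; 0, omega n ^ ((2 * n - 1) * h * k)] := by
  induction k with
  | zero =>
    ext i j
    fin_cases i <;> fin_cases j <;> simp
  | succ k ih =>
    rw [pow_succ, Units.val_mul, ih]
    simp [matA, Matrix.GeneralLinearGroup.mkOfDetNeZero, ← pow_add, mul_add]

theorem coe_matB : (matB : Matrix (Fin 2) (Fin 2) ℂ) = !![0, 1; 1, 0] := rfl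

theorem omega_pow_sq (n h : ℕ) [NeZero n] :
    omega n ^ ((2 * n - 1) * h * (2 * n - 1)) = omega n ^ h := by
  obtain ⟨k, rfl⟩ : ∃ k, n = k + 1 := Nat.exists_eq_succ_of_ne_zero (NeZero.ne n)
  have e : (2 * (k + 1) - 1) * h * (2 * (k + 1) - 1) = 4 * (k + 1) * (k * h) + h := by
    have h' : 2 * (k + 1) - 1 = 2 * k + 1 := by omega
    rw [h']; ring
  rw [e, pow_add, pow_mul, omega_pow, one_pow, one_mul]

/-- The two-dimensional matrix representation `ρ^h` of `SD_{8n}`, with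
`ρ^h(a) = diag (ω ^ h, ω ^ ((2n - 1) h))` and `ρ^h(b)` exchanging the coordinates. -/
def rho (n : ℕ) [NeZero n] (h : ℕ) : SD n →* GL (Fin 2) ℂ :=
  lift n (matA n h) matB
    (by
      apply Units.ext
      rw [coe_matA_pow, mul_comm h, pow_mul, omega_pow, mul_comm _ (4 * n), pow_mul, omega_pow,
        one_pow, one_pow, Units.val_one, Matrix.one_fin_two])
    (by
      apply Units.ext
      rw [sq, Units.val_mul, coe_matB]
      simp [Matrix.one_fin_two])
    (by
      apply Units.ext
      rw [coe_matA_pow, omega_pow_sq, Units.val_mul, Units.val_mul, coe_matB,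
        ← pow_one (matA n h), coe_matA_pow]
      simp [mul_comm h])

/-- The character of `ρ^h`, `g ↦ tr ρ^h(g)`. For `h` in `CdagEven n` it is written `ς_h`, for `h` in
`CdagOdd n` it is written `ψ_h`. -/
def rhoChar (n : ℕ) [NeZero n] (h : ℕ) (g : SD n) : ℂ :=
  Matrix.trace (rho n h g : Matrix (Fin 2) (Fin 2) ℂ)

/-! ### Index sets -/

/-- `C₁ = {0, 2, 4, …, 2n}`. -/
def C1 (n : ℕ) : Finset ℕ := (Finset.range (2 * n + 1)).filter Even

/-- `{1, 3, 5, …, n - 1}` for even `n`. -/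
def C2even (n : ℕ) : Finset ℕ := (Finset.Icc 1 (n - 1)).filter Odd

/-- `{2n + 1, 2n + 3, …, 3n - 1}` for even `n`. -/
def C3even (n : ℕ) : Finset ℕ := (Finset.Icc (2 * n + 1) (3 * n - 1)).filter Odd

/-- `C₁ ∖ {0, 2n} = {2, 4, …, 2n - 2}`. -/
def CdagEven (n : ℕ) : Finset ℕ := C1 n \ {0, 2 * n}

/-- `{1, 3, …, n - 1} ∪ {2n + 1, 2n + 3, …, 3n - 1}` for even `n`. -/
def CdagOdd (n : ℕ) : Finset ℕ := C2even n ∪ C3even n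

/-- `S̄`: the remainders of `s (2n - 1)` modulo `4n`, for `s ∈ S`. -/
def bar (n : ℕ) (S : Finset ℕ) : Finset ℕ := S.image fun s => s * (2 * n - 1) % (4 * n)

end SemiDihedral

end

/-!
By Schur's lemma, the operator attached to a character whose representation has one-dimensional
endomorphism algebra is idempotent, so the dimension of its image is its trace. On the tensors of
basis vectors `P_g` is a permutation, which fixes exactly those that are constant on the cycles of
`g`; hence the trace is `χ(1) / |G| * ∑ g, χ(g) * m ^ c(g)`, where `c(g)` is the number of cycles.

In `SD_{8n}`, the rotation `a ^ k` has `gcd(4n, k)` cycles. The square of `a ^ k * b` is the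
translation by `2nk`. For odd `k` this is the translation by `2n`, so all cycles of `a ^ k * b` have
length four; for even `k` it is trivial, and for even `n` the involution `a ^ k * b` has exactly two
fixed points. In the remaining sums `k` is reflected to `4n - k`, under which the character of `ρ^h`
is symmetric when `h * k` is even and antisymmetric when `h * k` is odd.
-/

noncomputable section

namespace SemiDihedral

section IrreducibleCharacter

open Representation

variable {k G W : Type*} [Field k] [Group G] [AddCommGroup W] [Module k W]
  {ρ : Representation k G W}

theorem finrank_intertwiningMap_self_eq_one [Nontrivial W]
    (h : ∀ f : IntertwiningMap ρ ρ, ∃ c : k, ∀ w, c • w = f w) :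
    Module.finrank k (IntertwiningMap ρ ρ) = 1 := by
  have hne : IntertwiningMap.id ρ ≠ 0 := fun h0 =>
    have ⟨w, hw⟩ := exists_ne (0 : W)
    hw (DFunLike.congr_fun h0 w)
  refine (finrank_eq_one_iff_of_nonzero' _ hne).2 fun f => (h f).imp fun c hc => ?_
  exact DFunLike.ext _ _ hc

variable [Fintype G]

theorem commute_sum_character_smul_inv (ρ : Representation k G W) (h : G) :
    Commute (∑ g, ρ.character g • ρ g⁻¹) (ρ h) := by
  rw [Commute, SemiconjBy, Finset.sum_mul, Finset.mul_sum]
  refine Fintype.sum_equiv (MulAut.conj h⁻¹).toEquiv _ _ fun g => ?_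
  simp only [MulEquiv.toEquiv_eq_coe, EquivLike.coe_coe, MulAut.conj_apply, char_conj,
    smul_mul_assoc, mul_smul_comm, ← map_mul]
  congr 2
  group

variable [CharZero k] [FiniteDimensional k W]

theorem sum_character_mul_character_inv (hρ : Module.finrank k (IntertwiningMap ρ ρ) = 1) :
    ∑ g, ρ.character g * ρ.character g⁻¹ = Fintype.card G := by
  have hcard : (Nat.card G : k) ≠ 0 := by exact_mod_cast Nat.card_pos.ne'
  have : Invertible (Nat.card G : k) := invertibleOfNonzero hcard
  have h := card_inv_mul_sum_char_mul_char_eq_finrank ρ ρ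
  rwa [hρ, Nat.cast_one, inv_mul_eq_one₀ hcard, Nat.card_eq_fintype_card, eq_comm] at h

theorem character_one_smul_sum_character_smul_inv
    (hρ : Module.finrank k (IntertwiningMap ρ ρ) = 1) :
    ρ.character 1 • ∑ g, ρ.character g • ρ g⁻¹ = (Fintype.card G : k) • 1 := by
  have : Nontrivial (IntertwiningMap ρ ρ) := Module.nontrivial_of_finrank_eq_succ hρ
  obtain ⟨c, hc⟩ := (finrank_eq_one_iff_of_nonzero' 1 one_ne_zero).1 hρ
    ⟨∑ g, ρ.character g • ρ g⁻¹, fun h => commute_sum_character_smul_inv ρ h⟩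
  replace hc : c • (1 : Module.End k W) = ∑ g, ρ.character g • ρ g⁻¹ :=
    congrArg IntertwiningMap.toLinearMap hc
  have htrace : c * ρ.character 1 = Fintype.card G := by
    rw [char_one, ← LinearMap.trace_one, ← smul_eq_mul, ← map_smul, hc, map_sum,
      ← sum_character_mul_character_inv hρ]
    simp only [map_smul, smul_eq_mul, character]
  rw [← hc, smul_smul, mul_comm, htrace]

theorem character_convolution (hρ : Module.finrank k (IntertwiningMap ρ ρ) = 1) (h : G) :
    ρ.character 1 / Fintype.card G * ∑ g, ρ.character g * ρ.character (g⁻¹ * h) =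
      ρ.character h := by
  have hcard : (Fintype.card G : k) ≠ 0 := by exact_mod_cast Fintype.card_ne_zero
  have key := congrArg (fun f => LinearMap.trace k W (f * ρ h))
    (character_one_smul_sum_character_smul_inv hρ)
  simp only [smul_mul_assoc, Finset.sum_mul, one_mul, ← map_mul, map_smul, map_sum,
    smul_eq_mul] at key
  rw [div_mul_eq_mul_div, div_eq_iff hcard, mul_comm (ρ.character h)]
  exact key

end IrreducibleCharacter

section Permutations

open Subgroup

variable {ι κ : Type*}

/-- The number of cycles of `σ`, each fixed point counting as a cycle of length one. -/
def cycleCount (σ : Equiv.Perm ι) : ℕ :=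
  Nat.card (MulAction.orbitRel.Quotient (zpowers σ) ι)

theorem apply_eq_of_mem_zpowers {σ τ : Equiv.Perm ι} {p : ι → κ} (hp : p ∘ σ.symm = p)
    (hτ : τ ∈ zpowers σ) (i : ι) : p (τ i) = p i := by
  let := arrowAction (G := Equiv.Perm ι) (A := ι) (B := κ)
  have hle : zpowers σ ≤ MulAction.stabilizer (Equiv.Perm ι) p := zpowers_le.2 hp
  exact congrFun (hle (inv_mem hτ)) i

/-- The functions invariant under `σ` are the functions on the set of cycles of `σ`. -/
def invariantFunctionsEquiv (σ : Equiv.Perm ι) :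
    {p : ι → κ // p ∘ σ.symm = p} ≃ (MulAction.orbitRel.Quotient (zpowers σ) ι → κ) where
  toFun p := Quotient.lift p.1 (by
    rintro _ j ⟨⟨τ, hτ⟩, rfl⟩
    exact apply_eq_of_mem_zpowers p.2 hτ j)
  invFun q := ⟨fun i => q ⟦i⟧, funext fun i =>
    congrArg q (Quotient.sound ⟨⟨σ⁻¹, inv_mem (mem_zpowers σ)⟩, rfl⟩)⟩
  left_inv _ := rfl
  right_inv q := funext fun x => x.inductionOn fun _ => rfl

variable [Finite ι]

theorem cycleCount_mul_orderOf (σ : Equiv.Perm ι) :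
    cycleCount σ * orderOf σ =
      ∑ j ∈ Finset.range (orderOf σ), (Function.fixedPoints (σ ^ j)).ncard := by
  classical
  have := Fintype.ofFinite ι
  rw [cycleCount, Nat.card_eq_fintype_card, ← Fintype.card_zpowers,
    ← MulAction.sum_card_fixedBy_eq_card_orbits_mul_card_group, Fintype.card_zpowers,
    ← Fin.sum_univ_eq_sum_range (fun j => (Function.fixedPoints (σ ^ j)).ncard)]
  refine (Fintype.sum_equiv (finEquivZPowers (isOfFinOrder_of_finite σ)) _ _ fun j => ?_).symm
  rw [← Nat.card_eq_fintype_card, finEquivZPowers_apply]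
  rfl

theorem cycleCount_mul_orderOf_of_semiregular {σ : Equiv.Perm ι}
    (hσ : ∀ j i, (σ ^ j) i = i → σ ^ j = 1) : cycleCount σ * orderOf σ = Nat.card ι := by
  rw [cycleCount_mul_orderOf, Finset.sum_eq_single_of_mem 0 (Finset.mem_range.2 (orderOf_pos σ))]
  · simp [Function.fixedPoints_id]
  · intro j hj hj0
    refine (Set.ncard_eq_zero).2 (Set.eq_empty_of_forall_notMem fun i hi => ?_)
    exact pow_ne_one_of_lt_orderOf hj0 (Finset.mem_range.1 hj) (hσ j i hi)

theorem two_mul_cycleCount {σ : Equiv.Perm ι} (hσ : σ ^ 2 = 1) :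
    2 * cycleCount σ = Nat.card ι + (Function.fixedPoints σ).ncard := by
  rcases (Nat.dvd_prime Nat.prime_two).1 (orderOf_dvd_of_pow_eq_one hσ) with h | h
  · have h1 : σ = 1 := orderOf_eq_one_iff.1 h
    have hburnside := cycleCount_mul_orderOf σ
    rw [h, mul_one, Finset.sum_range_one, pow_zero] at hburnside
    rw [hburnside, h1]
    simp [Function.fixedPoints_id, two_mul]
  · have hburnside := cycleCount_mul_orderOf σ
    rw [h, Finset.sum_range_succ, Finset.sum_range_one, pow_zero, pow_one] at hburnside
    rw [mul_comm, hburnside]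
    simp [Function.fixedPoints_id]

theorem four_mul_cycleCount {σ : Equiv.Perm ι} (hσ : σ ^ 4 = 1) (hfree : ∀ i, (σ ^ 2) i ≠ i) :
    4 * cycleCount σ = Nat.card ι := by
  cases isEmpty_or_nonempty ι
  · simp [cycleCount]
  have hne : σ ^ 2 ≠ 1 := fun h => hfree (Classical.arbitrary ι) (by rw [h]; rfl)
  have hord : orderOf σ = 4 := orderOf_eq_prime_pow (p := 2) (n := 1) hne hσ
  rw [mul_comm, ← hord]
  have hpow (l : ℕ) (hl : Odd l) : σ ^ (2 * l) = σ ^ 2 := by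
    obtain ⟨s, rfl⟩ := hl
    rw [show 2 * (2 * s + 1) = 4 * s + 2 by ring, pow_add, pow_mul, hσ, one_pow, one_mul]
  refine cycleCount_mul_orderOf_of_semiregular fun j i hi => ?_
  rcases Nat.even_or_odd j with hj | hj
  · obtain ⟨l, rfl⟩ := hj.two_dvd
    rcases Nat.even_or_odd l with hl | hl
    · obtain ⟨s, rfl⟩ := hl.two_dvd
      rw [show 2 * (2 * s) = 4 * s by ring, pow_mul, hσ, one_pow]
    · exact absurd (hpow l hl ▸ hi) (hfree i)
  · refine absurd ?_ (hfree i)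
    rw [← hpow j hj, mul_comm, pow_mul, sq, Equiv.Perm.mul_apply, hi, hi]

theorem cycleCount_addRight {A : Type*} [AddGroup A] [Finite A] (x : A) :
    cycleCount (Equiv.addRight x) * addOrderOf x = Nat.card A := by
  have hpow (j : ℕ) : (Equiv.addRight x : Equiv.Perm A) ^ j = Equiv.addRight (j • x) := by simp
  have hord : orderOf (Equiv.addRight x) = addOrderOf x := by
    refine Nat.dvd_right_iff_eq.1 fun j => ?_
    rw [orderOf_dvd_iff_pow_eq_one, addOrderOf_dvd_iff_nsmul_eq_zero, hpow, Equiv.Perm.ext_iff]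
    simp
  rw [← hord]
  refine cycleCount_mul_orderOf_of_semiregular fun j y hy => ?_
  rw [hpow, Equiv.coe_addRight, add_eq_left] at hy
  rw [hpow, hy, Equiv.addRight_zero]

end Permutations

section SymmetryClass

theorem finrank_range_of_isIdempotentElem {k M : Type*} [Field k] [AddCommGroup M] [Module k M]
    [FiniteDimensional k M] {f : Module.End k M} (hf : IsIdempotentElem f) :
    (Module.finrank k (LinearMap.range f) : k) = LinearMap.trace k M f :=
  ((LinearMap.isProj_range_iff_isIdempotentElem f).2 hf).trace.symm

theorem trace_reindex {R ι V : Type*} [CommRing R] [StrongRankCondition R] [Finite ι]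
    [AddCommGroup V] [Module R V] [Module.Free R V] [Module.Finite R V] (σ : Equiv.Perm ι) :
    LinearMap.trace R (⨂[R] _ : ι, V) (PiTensorProduct.reindex R (fun _ => V) σ).toLinearMap =
      (Module.finrank R V : R) ^ cycleCount σ := by
  classical
  have := Fintype.ofFinite ι
  let B := Basis.piTensorProduct fun _ : ι => Module.finBasis R V
  have hB (p) : PiTensorProduct.reindex R (fun _ : ι => V) σ (B p) = B (p ∘ σ.symm) := by
    rw [Basis.piTensorProduct_apply, Basis.piTensorProduct_apply]
    exact PiTensorProduct.reindex_tprod σ _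
  rw [LinearMap.trace_eq_matrix_trace R B, Matrix.trace]
  simp_rw [Matrix.diag_apply, LinearMap.toMatrix_apply, LinearEquiv.coe_coe, hB,
    Module.Basis.repr_self, Finsupp.single_apply]
  rw [Finset.sum_boole, ← Fintype.card_subtype, ← Nat.card_eq_fintype_card,
    Nat.card_congr (invariantFunctionsEquiv σ), Nat.card_fun]
  simp [cycleCount]

/-- The representation of `G` on `⨂_{i ∈ ι} V` permuting the tensor factors through `T`. -/
def permRep {G ι : Type*} [Group G] (T : G →* Equiv.Perm ι)
    (V : Type*) [AddCommGroup V] [Module ℂ V] : Representation ℂ G (⨂[ℂ] _ : ι, V) where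
  toFun g := (PiTensorProduct.reindex ℂ (fun _ : ι => V) (T g)).toLinearMap
  map_one' := by
    rw [map_one]
    exact congrArg LinearEquiv.toLinearMap
      (PiTensorProduct.reindex_refl (R := ℂ) (s := fun _ : ι => V))
  map_mul' g h := by
    ext v
    simp only [LinearMap.compMultilinearMap_apply, LinearEquiv.coe_coe,
      PiTensorProduct.reindex_tprod, Module.End.mul_apply, map_mul]
    rfl

theorem isIdempotentElem_sum_smul {k G A : Type*} [CommRing k] [Group G] [Fintype G] [Ring A]
    [Algebra k A] (φ : G →* A) {χ : G → k} {c : k} (hχ : ∀ h, c * ∑ g, χ g * χ (g⁻¹ * h) = χ h) :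
    IsIdempotentElem (c • ∑ g, χ g • φ g) := by
  have hmul : (∑ g, χ g • φ g) * ∑ h, χ h • φ h = ∑ h, (∑ g, χ g * χ (g⁻¹ * h)) • φ h := by
    simp_rw [Finset.sum_mul_sum, Finset.sum_smul, smul_mul_smul_comm, ← map_mul]
    conv_rhs => rw [Finset.sum_comm]
    refine Finset.sum_congr rfl fun g _ => ?_
    exact Fintype.sum_equiv (Equiv.mulLeft g) _ _ fun h => by simp
  rw [IsIdempotentElem, smul_mul_smul_comm, hmul, mul_smul, Finset.smul_sum]
  simp_rw [smul_smul, hχ]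

theorem finrank_symmetryClass {G ι W V : Type*} [Group G] [Fintype G] [Finite ι]
    [AddCommGroup W] [Module ℂ W] [FiniteDimensional ℂ W]
    [AddCommGroup V] [Module ℂ V] [FiniteDimensional ℂ V] (T : G →* Equiv.Perm ι)
    {ρ : Representation ℂ G W}
    (hρ : Module.finrank ℂ (Representation.IntertwiningMap ρ ρ) = 1) :
    (Module.finrank ℂ (symmetryClass T ρ.character V) : ℂ) =
      ρ.character 1 / Fintype.card G *
        ∑ g, ρ.character g * (Module.finrank ℂ V : ℂ) ^ cycleCount (T g) := by
  have := Fintype.ofFinite ι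
  have hidem : IsIdempotentElem (symmetrizer T ρ.character V) :=
    isIdempotentElem_sum_smul (permRep T V) (character_convolution hρ)
  rw [symmetryClass, finrank_range_of_isIdempotentElem hidem, symmetrizer]
  simp_rw [map_smul, map_sum, map_smul, trace_reindex, smul_eq_mul]

end SymmetryClass

section Group

/-- The generator `a` of `SD n`. -/
abbrev genA (n : ℕ) : SD n := PresentedGroup.of Gen.a

/-- The generator `b` of `SD n`. -/
abbrev genB (n : ℕ) : SD n := PresentedGroup.of Gen.b

section Lift

variable {H : Type*} [Group H] {n : ℕ} {x y : H} (h₁ : x ^ (4 * n) = 1) (h₂ : y ^ 2 = 1)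
  (h₃ : y * x * y = x ^ (2 * n - 1))

theorem lift_genA : lift n x y h₁ h₂ h₃ (genA n) = x := PresentedGroup.toGroup.of _

theorem lift_genB : lift n x y h₁ h₂ h₃ (genB n) = y := PresentedGroup.toGroup.of _

end Lift

theorem genB_mul_genB (n : ℕ) : genB n * genB n = 1 := by rw [← sq, b_sq]

theorem genB_mul_genA (n : ℕ) : genB n * genA n = genA n ^ (2 * n - 1) * genB n := by
  rw [← b_a_b, mul_assoc _ (genB n), genB_mul_genB, mul_one]

variable (n : ℕ) [NeZero n]

theorem exists_eq_genA_pow_or_mul_genB (g : SD n) :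
    ∃ k : ℕ, g = genA n ^ k ∨ g = genA n ^ k * genB n := by
  have hg : g ∈ Submonoid.closure (Set.range (PresentedGroup.of (rels := rels n))) := by
    rw [← Subgroup.closure_toSubmonoid_of_finite, PresentedGroup.closure_range_of]
    exact Subgroup.mem_top g
  induction hg using Submonoid.closure_induction_right with
  | one => exact ⟨0, Or.inl (pow_zero _).symm⟩
  | mul_right g _ x hx ih =>
    obtain ⟨i, rfl⟩ := hx
    obtain ⟨k, rfl | rfl⟩ := ih <;> cases i
    · exact ⟨k + 1, Or.inl (pow_succ _ _).symm⟩
    · exact ⟨k, Or.inr rfl⟩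
    · exact ⟨k + (2 * n - 1), Or.inr (by rw [mul_assoc, genB_mul_genA, ← mul_assoc, ← pow_add])⟩
    · exact ⟨k, Or.inl (by rw [mul_assoc, genB_mul_genB, mul_one])⟩

theorem toPerm_genA_pow (k : ℕ) : toPerm n (genA n ^ k) = Equiv.addRight (k : ZMod (4 * n)) := by
  ext1 t
  rw [map_pow, toPerm, lift_genA, permA_pow, Equiv.coe_addRight]

theorem toPerm_genA_pow_mul_genB_apply (k : ℕ) (t : ZMod (4 * n)) :
    toPerm n (genA n ^ k * genB n) t = (2 * n - 1) * t + k := by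
  rw [map_mul, Equiv.Perm.mul_apply, toPerm_genA_pow, toPerm, lift_genB]
  rfl

theorem orderOf_genA : orderOf (genA n) = 4 * n := by
  refine Nat.dvd_antisymm (orderOf_dvd_of_pow_eq_one (a_pow n)) ?_
  have h := congrArg (fun g => toPerm n g 0) (pow_orderOf_eq_one (genA n))
  simp only [toPerm_genA_pow, Equiv.coe_addRight, zero_add, map_one, Equiv.Perm.one_apply] at h
  exact (ZMod.natCast_eq_zero_iff _ _).1 h

theorem genA_pow_ne_genA_pow_mul_genB (i j : ℕ) : genA n ^ i ≠ genA n ^ j * genB n := by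
  intro h
  have h1 := congrArg (fun g => (linearChar n 1 (-1) (by simp) (by simp) g : ℂ)) h
  simp only [linearChar, map_mul, map_pow, lift_genA, lift_genB, one_pow, one_mul] at h1
  norm_num at h1

/-- The enumeration of `SD n` by the normal forms `a ^ k` and `a ^ k * b` with `k < 4n`. -/
def normalForm : Fin (4 * n) ⊕ Fin (4 * n) ≃ SD n :=
  Equiv.ofBijective (Sum.elim (fun k => genA n ^ (k : ℕ)) (fun k => genA n ^ (k : ℕ) * genB n)) (by
    have hinj (i j : Fin (4 * n)) (h : genA n ^ (i : ℕ) = genA n ^ (j : ℕ)) : i = j :=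
      Fin.ext (pow_injOn_Iio_orderOf (by simp [orderOf_genA]) (by simp [orderOf_genA]) h)
    have hmod (k : ℕ) : genA n ^ (k % (4 * n)) = genA n ^ k := by
      simpa only [orderOf_genA] using pow_mod_orderOf (genA n) k
    have hpos : 0 < 4 * n := NeZero.pos _
    constructor
    · rintro (i | i) (j | j) h
      · exact congrArg Sum.inl (hinj i j h)
      · exact absurd h (genA_pow_ne_genA_pow_mul_genB n i j)
      · exact absurd h.symm (genA_pow_ne_genA_pow_mul_genB n j i)
      · exact congrArg Sum.inr (hinj i j (mul_right_cancel h))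
    · intro g
      obtain ⟨k, rfl | rfl⟩ := exists_eq_genA_pow_or_mul_genB n g
      · exact ⟨Sum.inl ⟨k % (4 * n), Nat.mod_lt _ hpos⟩, hmod k⟩
      · exact ⟨Sum.inr ⟨k % (4 * n), Nat.mod_lt _ hpos⟩, congrArg (· * genB n) (hmod k)⟩)

theorem sum_SD {M : Type*} [AddCommMonoid M] (F : SD n → M) :
    ∑ g, F g = ∑ k ∈ Finset.range (4 * n), F (genA n ^ k) +
      ∑ k ∈ Finset.range (4 * n), F (genA n ^ k * genB n) := by
  rw [← (normalForm n).sum_comp, Fintype.sum_sum_type,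
    ← Fin.sum_univ_eq_sum_range (fun k => F (genA n ^ k)),
    ← Fin.sum_univ_eq_sum_range (fun k => F (genA n ^ k * genB n))]
  rfl

theorem card_SD : Fintype.card (SD n) = 8 * n := by
  rw [← Fintype.card_congr (normalForm n), Fintype.card_sum, Fintype.card_fin]
  ring

end Group

section CycleCount

variable (n : ℕ) [NeZero n]

theorem cycleCount_genA_pow (k : ℕ) : cycleCount (toPerm n (genA n ^ k)) = Nat.gcd (4 * n) k := by
  have hn : 4 * n ≠ 0 := NeZero.ne _
  have hgcd : 0 < Nat.gcd (4 * n) k := Nat.gcd_pos_of_pos_left _ hn.bot_lt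
  have h := cycleCount_addRight (k : ZMod (4 * n))
  rw [Nat.card_zmod, ZMod.addOrderOf_coe k hn] at h
  rw [toPerm_genA_pow]
  refine Nat.eq_of_mul_eq_mul_right (Nat.div_pos (Nat.gcd_le_left _ hn.bot_lt) hgcd) ?_
  rw [h, Nat.mul_div_cancel' (Nat.gcd_dvd_left _ _)]

theorem toPerm_genA_pow_mul_genB_sq_apply (k : ℕ) (t : ZMod (4 * n)) :
    (toPerm n (genA n ^ k * genB n) ^ 2) t = t + (2 * n * k : ℕ) := by
  rw [sq, Equiv.Perm.mul_apply, toPerm_genA_pow_mul_genB_apply, toPerm_genA_pow_mul_genB_apply]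
  push_cast
  linear_combination t * two_mul_sub_one_sq n

theorem natCast_two_mul_eq_zero_iff (k : ℕ) : ((2 * n * k : ℕ) : ZMod (4 * n)) = 0 ↔ Even k := by
  rw [ZMod.natCast_eq_zero_iff, show 4 * n = 2 * n * 2 by ring,
    Nat.mul_dvd_mul_iff_left (NeZero.pos _), even_iff_two_dvd]

theorem cycleCount_genA_pow_mul_genB_of_odd {k : ℕ} (hk : Odd k) :
    cycleCount (toPerm n (genA n ^ k * genB n)) = n := by
  set τ := toPerm n (genA n ^ k * genB n)
  have hsq (t) : (τ ^ 2) t = t + (2 * n * k : ℕ) := toPerm_genA_pow_mul_genB_sq_apply n k t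
  have hfree (t) : (τ ^ 2) t ≠ t := by
    rwa [hsq, ne_eq, add_eq_left, natCast_two_mul_eq_zero_iff, Nat.not_even_iff_odd]
  have hone : τ ^ 4 = 1 := by
    ext1 t
    have hzero := (natCast_two_mul_eq_zero_iff n (2 * k)).2 (even_two_mul k)
    rw [show 2 * n * (2 * k) = 2 * n * k + 2 * n * k by ring, Nat.cast_add] at hzero
    rw [show τ ^ 4 = τ ^ 2 * τ ^ 2 by rw [← pow_add], Equiv.Perm.mul_apply, hsq, hsq, add_assoc,
      hzero, add_zero, Equiv.Perm.one_apply]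
  have h := four_mul_cycleCount hone hfree
  rw [Nat.card_zmod] at h
  omega

theorem two_mul_eq_zero_iff (x : ZMod (4 * n)) : 2 * x = 0 ↔ x = 0 ∨ x = 2 * n := by
  have hval : (2 * n : ZMod (4 * n)).val = 2 * n := by
    have hlt : 2 * n < 4 * n := by have := NeZero.pos n; omega
    simpa only [Nat.cast_mul, Nat.cast_ofNat] using ZMod.val_cast_of_lt hlt
  rw [two_mul, ← neg_eq_iff_add_eq_zero, ZMod.neg_eq_self_iff, ← (ZMod.val_injective _).eq_iff,
    ← (ZMod.val_injective _).eq_iff, hval]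
  omega

theorem fixedPoints_genA_pow_mul_genB (hn : Even n) (l : ℕ) :
    Function.fixedPoints (toPerm n (genA n ^ (2 * l) * genB n)) =
      {-((n - 1) * l : ZMod (4 * n)), -((n - 1) * l : ZMod (4 * n)) + 2 * n} := by
  obtain ⟨r, hr⟩ := hn
  have hN : (4 * n : ZMod (4 * n)) = 0 := by exact_mod_cast ZMod.natCast_self (4 * n)
  have hnr : (n : ZMod (4 * n)) = 2 * r := by rw [hr]; push_cast; ring
  have hunit : 2 * ((n : ZMod (4 * n)) - 1) * (n - 1) = 2 := by
    linear_combination (r - 1 : ZMod (4 * n)) * hN + 2 * n * hnr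
  ext t
  -- Since `2 (n - 1)² = 2`, the fixed-point equation `2 (n - 1) t + 2 l = 0` can be solved
  -- for `2 t`.
  have key : (2 * n - 1) * t + (2 * l : ℕ) = t ↔ 2 * (t + (n - 1) * l) = 0 := by
    push_cast
    constructor <;> intro h
    · linear_combination (n - 1 : ZMod (4 * n)) * h - t * hunit
    · linear_combination (n - 1 : ZMod (4 * n)) * h - (l : ZMod (4 * n)) * hunit
  rw [Function.mem_fixedPoints, Function.IsFixedPt, toPerm_genA_pow_mul_genB_apply, key,
    two_mul_eq_zero_iff, Set.mem_insert_iff, Set.mem_singleton_iff, add_eq_zero_iff_eq_neg,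
    eq_neg_add_iff_add_eq, add_comm t]

theorem cycleCount_genA_pow_mul_genB_of_even (hn : Even n) {k : ℕ} (hk : Even k) :
    cycleCount (toPerm n (genA n ^ k * genB n)) = 2 * n + 1 := by
  have hsq : toPerm n (genA n ^ k * genB n) ^ 2 = 1 := by
    ext1 t
    rw [toPerm_genA_pow_mul_genB_sq_apply, (natCast_two_mul_eq_zero_iff n k).2 hk, add_zero,
      Equiv.Perm.one_apply]
  have hne : (2 * n : ZMod (4 * n)) ≠ 0 := by
    simpa using (natCast_two_mul_eq_zero_iff n 1).not.2 (by decide)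
  obtain ⟨l, rfl⟩ := hk.two_dvd
  have h := two_mul_cycleCount hsq
  rw [fixedPoints_genA_pow_mul_genB n hn, Set.ncard_pair (by simpa using hne),
    Nat.card_zmod] at h
  omega

end CycleCount

section Representations

open Representation

variable {k G : Type*} [Field k] [Group G]

/-- The one-dimensional representation with character `φ`. -/
def linearRep (φ : G →* kˣ) : Representation k G k :=
  (Algebra.lmul k k : k →* Module.End k k).comp ((Units.coeHom k).comp φ)

theorem character_linearRep (φ : G →* kˣ) (g : G) : (linearRep φ).character g = φ g :=
  Algebra.trace_self_apply (φ g : k)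

theorem finrank_intertwiningMap_linearRep (φ : G →* kˣ) :
    Module.finrank k (IntertwiningMap (linearRep φ) (linearRep φ)) = 1 :=
  finrank_intertwiningMap_self_eq_one fun f => ⟨f 1, fun w => by
    rw [smul_eq_mul, mul_comm, ← smul_eq_mul, ← map_smul, smul_eq_mul, mul_one]⟩

/-- The representation on column vectors given by invertible matrices. -/
def matrixRep {κ : Type*} [Fintype κ] [DecidableEq κ] (M : G →* GL κ k) :
    Representation k G (κ → k) where
  toFun g := Matrix.toLin' (M g)
  map_one' := by rw [map_one, Units.val_one, Matrix.toLin'_one, Module.End.one_eq_id]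
  map_mul' g h := by rw [map_mul, Units.val_mul, Matrix.toLin'_mul, Module.End.mul_eq_comp]

theorem matrixRep_apply {κ : Type*} [Fintype κ] [DecidableEq κ] (M : G →* GL κ k) (g : G)
    (v : κ → k) : matrixRep M g v = Matrix.mulVec (M g) v :=
  rfl

theorem character_matrixRep {κ : Type*} [Fintype κ] [DecidableEq κ] (M : G →* GL κ k) (g : G) :
    (matrixRep M).character g = (M g : Matrix κ κ k).trace :=
  Matrix.trace_toLin'_eq _

theorem finrank_intertwiningMap_matrixRep {M : G →* GL (Fin 2) k} {a b : G} {x y : k}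
    (ha : (M a : Matrix (Fin 2) (Fin 2) k) = !![x, 0; 0, y])
    (hb : (M b : Matrix (Fin 2) (Fin 2) k) = !![0, 1; 1, 0]) (hxy : x ≠ y) :
    Module.finrank k (IntertwiningMap (matrixRep M) (matrixRep M)) = 1 := by
  have hMa (v : Fin 2 → k) : matrixRep M a v = ![x * v 0, y * v 1] := by
    rw [matrixRep_apply, ha]
    simp [Matrix.cons_mulVec, Matrix.vecHead, Matrix.vecTail]
  have hMb (v : Fin 2 → k) : matrixRep M b v = ![v 1, v 0] := by
    rw [matrixRep_apply, hb]
    simp [Matrix.cons_mulVec, Matrix.vecHead, Matrix.vecTail]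
  refine finrank_intertwiningMap_self_eq_one fun f => ?_
  set u := f ![1, 0] with hu
  have hu1 : u 1 = 0 := by
    have he : matrixRep M a ![1, 0] = x • ![1, 0] := by rw [hMa]; simp
    have h := IntertwiningMap.isIntertwining _ _ f a ![1, 0]
    rw [he, map_smul, ← hu, hMa] at h
    exact (mul_eq_mul_right_iff.1 (congrFun h 1)).resolve_left hxy
  have hf : f ![0, 1] = ![0, u 0] := by
    have h := IntertwiningMap.isIntertwining _ _ f b ![1, 0]
    rwa [hMb, hMb, ← hu, hu1] at h
  refine ⟨u 0, fun w => ?_⟩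
  have hw : w = w 0 • ![1, 0] + w 1 • ![0, 1] := by
    ext i
    fin_cases i <;> simp
  rw [hw, map_add, map_smul, map_smul, hf, ← hu]
  ext i
  fin_cases i <;> simp [hu1, mul_comm]

end Representations

section DegreeTwoCharacters

variable (n : ℕ) [NeZero n]

theorem isPrimitiveRoot_omega : IsPrimitiveRoot (omega n) (4 * n) := by
  have hn : (n : ℂ) ≠ 0 := Nat.cast_ne_zero.2 (NeZero.ne n)
  convert Complex.isPrimitiveRoot_exp (4 * n) (NeZero.ne _) using 1
  rw [omega]
  congr 1
  push_cast
  field_simp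
  ring

theorem omega_pow_two_mul : omega n ^ (2 * n) = -1 :=
  (isPrimitiveRoot_omega n).pow (NeZero.pos _) (by ring : 4 * n = 2 * n * 2)
    |>.eq_neg_one_of_two_right

theorem omega_pow_mul_omega_pow (j : ℕ) : omega n ^ j * omega n ^ ((2 * n - 1) * j) = (-1) ^ j := by
  have hj : j + (2 * n - 1) * j = 2 * n * j := by
    rw [Nat.sub_one_mul, Nat.add_sub_cancel' (Nat.le_mul_of_pos_left j (NeZero.pos _))]
  rw [← pow_add, hj, pow_mul, omega_pow_two_mul]

theorem omega_pow_ne_omega_pow (hn : Even n) {h : ℕ} (hh : ¬ 2 * n ∣ h) :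
    omega n ^ h ≠ omega n ^ ((2 * n - 1) * h) := by
  intro heq
  have hpow : omega n ^ (2 * (n - 1) * h) = 1 := by
    have hsplit : (2 * n - 1) * h = h + 2 * (n - 1) * h := by
      have hn0 := NeZero.pos n
      rw [show 2 * n - 1 = 1 + 2 * (n - 1) by omega, one_add_mul]
    rw [hsplit, pow_add] at heq
    exact (left_eq_mul₀ (pow_ne_zero _ (omega_ne_zero n))).1 heq
  rw [(isPrimitiveRoot_omega n).pow_eq_one_iff_dvd, show 4 * n = 2 * (2 * n) by ring, mul_assoc,
    Nat.mul_dvd_mul_iff_left two_pos] at hpow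
  refine hh (Nat.Coprime.dvd_of_dvd_mul_left (Nat.Coprime.mul_left ?_ ?_) hpow)
  · exact Nat.coprime_two_left.2 (Nat.Even.sub_odd (NeZero.pos n) hn odd_one)
  · exact (Nat.coprime_self_sub_right (NeZero.pos n)).2 (Nat.coprime_one_right n)

theorem coe_rho_genA_pow (h k : ℕ) : (rho n h (genA n ^ k) : Matrix (Fin 2) (Fin 2) ℂ) =
    !![omega n ^ (h * k), 0; 0, omega n ^ ((2 * n - 1) * (h * k))] := by
  rw [map_pow, rho, lift_genA, coe_matA_pow, mul_assoc]

theorem coe_rho_genB (h : ℕ) : (rho n h (genB n) : Matrix (Fin 2) (Fin 2) ℂ) =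
    !![0, 1; 1, 0] := by
  rw [rho, lift_genB, coe_matB]

theorem rhoChar_genA_pow (h k : ℕ) :
    rhoChar n h (genA n ^ k) = omega n ^ (h * k) + omega n ^ ((2 * n - 1) * (h * k)) := by
  rw [rhoChar, coe_rho_genA_pow, Matrix.trace_fin_two_of]

theorem rhoChar_genA_pow_mul_genB (h k : ℕ) : rhoChar n h (genA n ^ k * genB n) = 0 := by
  rw [rhoChar, map_mul, Units.val_mul, coe_rho_genA_pow, coe_rho_genB, Matrix.mul_fin_two,
    Matrix.trace_fin_two_of]
  ring

theorem rhoChar_one (h : ℕ) : rhoChar n h 1 = 2 := by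
  rw [rhoChar, map_one, Units.val_one, Matrix.trace_one, Fintype.card_fin, Nat.cast_ofNat]

theorem rhoChar_genA_pow_of_even {h k : ℕ} (hhk : Even (h * k)) :
    rhoChar n h (genA n ^ k) = (2 * Real.cos (h * k * Real.pi / (2 * n)) : ℝ) := by
  have hexp : omega n ^ (h * k) =
      Complex.exp ((h * k * Real.pi / (2 * n) : ℝ) * Complex.I) := by
    rw [omega, ← Complex.exp_nat_mul]
    push_cast
    ring_nf
  have hinv : omega n ^ ((2 * n - 1) * (h * k)) =
      Complex.exp (-(h * k * Real.pi / (2 * n) : ℝ) * Complex.I) := by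
    rw [neg_mul, Complex.exp_neg, ← hexp]
    exact eq_inv_of_mul_eq_one_right ((omega_pow_mul_omega_pow n _).trans hhk.neg_one_pow)
  rw [rhoChar_genA_pow, hexp, hinv, ← Complex.two_cos]
  push_cast
  rfl

theorem rhoChar_genA_pow_of_odd {h k l : ℕ} (hh : Odd h) (hk : Odd k) (hkl : k + l = 4 * n) :
    rhoChar n h (genA n ^ l) = -rhoChar n h (genA n ^ k) := by
  have hinv (i : ℕ) : omega n ^ (i * k) * omega n ^ (i * l) = 1 := by
    rw [← pow_add, ← mul_add, hkl, mul_comm, pow_mul, omega_pow, one_pow]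
  have hneg : omega n ^ (h * k) * omega n ^ ((2 * n - 1) * (h * k)) = -1 :=
    (omega_pow_mul_omega_pow n _).trans (hh.mul hk).neg_one_pow
  have hx := hinv h
  have hy := hinv ((2 * n - 1) * h)
  rw [mul_assoc, mul_assoc] at hy
  rw [rhoChar_genA_pow, rhoChar_genA_pow]
  linear_combination (- omega n ^ ((2 * n - 1) * (h * k))) * hx - omega n ^ (h * k) * hy
    + (omega n ^ (h * l) + omega n ^ ((2 * n - 1) * (h * l))) * hneg

end DegreeTwoCharacters

section IndexSets

theorem mem_CdagEven (n k : ℕ) : k ∈ CdagEven n ↔ Even k ∧ 0 < k ∧ k < 2 * n := by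
  simp only [CdagEven, C1, Finset.mem_sdiff, Finset.mem_filter, Finset.mem_range,
    Finset.mem_insert, Finset.mem_singleton, Nat.even_iff]
  omega

theorem mem_CdagOdd (n k : ℕ) : k ∈ CdagOdd n ↔ Odd k ∧ (k < n ∨ (2 * n < k ∧ k < 3 * n)) := by
  simp only [CdagOdd, C2even, C3even, Finset.mem_union, Finset.mem_filter, Finset.mem_Icc,
    Nat.odd_iff]
  omega

theorem not_two_mul_dvd_of_odd {n h : ℕ} (hh : Odd h) : ¬ 2 * n ∣ h :=
  fun hdvd => Nat.not_even_iff_odd.2 hh (even_iff_two_dvd.2 (dvd_of_mul_right_dvd hdvd))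

theorem not_two_mul_dvd_of_mem_CdagEven {n h : ℕ} (hh : h ∈ CdagEven n) : ¬ 2 * n ∣ h := by
  obtain ⟨-, hpos, hlt⟩ := (mem_CdagEven n h).1 hh
  exact Nat.not_dvd_of_pos_of_lt hpos hlt

theorem CdagEven_eq_image (n : ℕ) : CdagEven n = (Finset.Ico 1 n).image (2 * ·) := by
  ext k
  simp only [mem_CdagEven, Finset.mem_image, Finset.mem_Ico, Nat.even_iff]
  constructor
  · exact fun hk => ⟨k / 2, by omega⟩
  · rintro ⟨i, hi, rfl⟩
    omega

theorem mul_two_mul_sub_one_mod {n : ℕ} [NeZero n] {s : ℕ} (hs : Odd s) (hs' : s ≤ 4 * n) :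
    s * (2 * n - 1) % (4 * n) = (6 * n - s) % (4 * n) := by
  obtain ⟨q, hq⟩ := hs
  have h1 : 1 ≤ 2 * n := Nat.mul_pos two_pos (NeZero.pos n)
  refine Nat.ModEq.add_right_cancel' s (?_ : _ ≡ _ [MOD 4 * n])
  rw [Nat.sub_add_cancel (by omega), Nat.mul_sub_one,
    Nat.sub_add_cancel (Nat.le_mul_of_pos_right _ h1),
    show s * (2 * n) = 2 * n + 4 * n * q by rw [hq]; ring, show 6 * n = 2 * n + 4 * n * 1 by ring]
  exact (Nat.add_mul_mod_self_left _ _ _).trans (Nat.add_mul_mod_self_left _ _ _).symm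

theorem CdagOdd_union_bar {n : ℕ} [NeZero n] (hn : Even n) :
    CdagOdd n ∪ bar n (CdagOdd n) = (Finset.range (2 * n)).image (2 * · + 1) := by
  have hn0 := NeZero.pos n
  have hbar (s : ℕ) (hs : s ∈ CdagOdd n) :
      s * (2 * n - 1) % (4 * n) = if s < n then 2 * n - s else 6 * n - s := by
    rw [mem_CdagOdd] at hs
    rw [mul_two_mul_sub_one_mod hs.1 (by omega)]
    split_ifs with hsn
    · rw [Nat.mod_eq_sub_mod (by omega), Nat.mod_eq_of_lt (by omega)]
      omega
    · rw [Nat.mod_eq_of_lt (by omega)]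
  ext k
  rw [bar, Finset.image_congr hbar]
  simp only [Finset.mem_union, Finset.mem_image, Finset.mem_range, mem_CdagOdd]
  rw [Nat.even_iff] at hn
  simp only [Nat.odd_iff]
  constructor
  · rintro (hk | ⟨s, hs, rfl⟩)
    · exact ⟨k / 2, by omega⟩
    · exact ⟨(if s < n then 2 * n - s else 6 * n - s) / 2, by split_ifs <;> omega⟩
  · rintro ⟨i, hi, rfl⟩
    by_cases hi' : 2 * i + 1 < n ∨ 2 * n < 2 * i + 1 ∧ 2 * i + 1 < 3 * n
    · exact Or.inl ⟨by omega, hi'⟩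
    · refine Or.inr ⟨if 2 * i + 1 < 2 * n then 2 * n - (2 * i + 1) else 6 * n - (2 * i + 1), ?_⟩
      split_ifs <;> omega

theorem sum_range_two_mul {M : Type*} [AddCommMonoid M] (f : ℕ → M) (N : ℕ) :
    ∑ k ∈ Finset.range (2 * N), f k =
      ∑ i ∈ Finset.range N, f (2 * i) + ∑ i ∈ Finset.range N, f (2 * i + 1) := by
  induction N with
  | zero => simp
  | succ N ih =>
    rw [mul_add, mul_one, Finset.sum_range_succ, Finset.sum_range_succ, ih, Finset.sum_range_succ,
      Finset.sum_range_succ]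
    abel

theorem sum_range_four_mul {M : Type*} [AddCommMonoid M] (f : ℕ → M) (n : ℕ) :
    ∑ k ∈ Finset.range (4 * n), f k = ∑ i ∈ Finset.range (2 * n), f (2 * i) +
      ∑ i ∈ Finset.range (2 * n), f (2 * i + 1) := by
  rw [← sum_range_two_mul, show 2 * (2 * n) = 4 * n by ring]

theorem sum_even_of_symm {M : Type*} [AddCommMonoid M] (n : ℕ) [NeZero n] {f : ℕ → M}
    (hf : ∀ k l, k + l = 4 * n → f k = f l) :
    ∑ i ∈ Finset.range (2 * n), f (2 * i) = f 0 + f (2 * n) + 2 • ∑ k ∈ CdagEven n, f k := by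
  have hn := NeZero.pos n
  have hreflect : ∑ i ∈ Finset.Ico (n + 1) (2 * n), f (2 * i) =
      ∑ i ∈ Finset.Ico 1 n, f (2 * i) := by
    rw [show Finset.Ico (n + 1) (2 * n) = Finset.Ico (2 * n + 1 - n) (2 * n + 1 - 1) by
      congr 1; omega, ← Finset.sum_Ico_reflect _ _ (by omega)]
    refine Finset.sum_congr rfl fun i hi => hf _ _ ?_
    rw [Finset.mem_Ico] at hi
    omega
  rw [Finset.sum_range_eq_add_Ico _ (by omega), ← Finset.sum_Ico_consecutive _ hn (by omega),
    Finset.sum_eq_sum_Ico_succ_bot (by omega : n < 2 * n), hreflect, CdagEven_eq_image,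
    Finset.sum_image fun i _ j _ hij => by simpa using hij, two_nsmul, mul_zero]
  abel

theorem sum_odd_of_antisymm {R : Type*} [Ring R] [NoZeroDivisors R] [CharZero R] {n : ℕ}
    {f : ℕ → R}
    (hf : ∀ k l, Odd k → k + l = 4 * n → f l = -f k) :
    ∑ i ∈ Finset.range (2 * n), f (2 * i + 1) = 0 := by
  rw [← CharZero.eq_neg_self_iff, ← Finset.sum_neg_distrib,
    ← Finset.sum_range_reflect (fun i => f (2 * i + 1))]
  refine Finset.sum_congr rfl fun i hi => hf _ _ (odd_two_mul_add_one i) ?_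
  rw [Finset.mem_range] at hi
  omega

theorem gcd_eq_gcd_of_add_eq {N k l : ℕ} (h : k + l = N) : Nat.gcd N k = Nat.gcd N l := by
  rw [← h, Nat.gcd_add_self_left, add_comm, Nat.gcd_add_self_left, Nat.gcd_comm]

theorem gcd_four_mul_two_mul (n : ℕ) : Nat.gcd (4 * n) (2 * n) = 2 * n :=
  Nat.gcd_eq_right ⟨2, by ring⟩

theorem sum_neg_one_pow_mul_pow_gcd {R : Type*} [CommRing R] {n : ℕ} [NeZero n] (hn : Even n)
    (m : R) :
    ∑ k ∈ Finset.range (4 * n), (-1) ^ k * m ^ Nat.gcd (4 * n) k =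
      m ^ (4 * n) + m ^ (2 * n) + 2 * ∑ k ∈ CdagEven n, m ^ Nat.gcd (4 * n) k
        - ∑ k ∈ CdagOdd n ∪ bar n (CdagOdd n), m ^ Nat.gcd (4 * n) k := by
  have heven := sum_even_of_symm n fun k l hkl =>
    congrArg (m ^ ·) (gcd_eq_gcd_of_add_eq hkl)
  rw [Nat.gcd_zero_right, gcd_four_mul_two_mul, nsmul_eq_mul, Nat.cast_ofNat] at heven
  rw [sum_range_four_mul, CdagOdd_union_bar hn,
    Finset.sum_image fun i _ j _ hij => by simpa using hij]
  simp only [(even_two_mul _).neg_one_pow, (odd_two_mul_add_one _).neg_one_pow, one_mul, neg_mul,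
    Finset.sum_neg_distrib, heven, ← sub_eq_add_neg]

end IndexSets

section Dimensions

variable (n : ℕ) [NeZero n] (V : Type*) [AddCommGroup V] [Module ℂ V] [FiniteDimensional ℂ V]

theorem finrank_symmetryClass_toPerm {W : Type*} [AddCommGroup W] [Module ℂ W]
    [FiniteDimensional ℂ W] {ρ : Representation ℂ (SD n) W}
    (hρ : Module.finrank ℂ (Representation.IntertwiningMap ρ ρ) = 1) :
    (Module.finrank ℂ (symmetryClass (toPerm n) ρ.character V) : ℂ) =
      ρ.character 1 / (8 * n) *
        (∑ k ∈ Finset.range (4 * n),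
            ρ.character (genA n ^ k) * (Module.finrank ℂ V : ℂ) ^ Nat.gcd (4 * n) k +
          ∑ k ∈ Finset.range (4 * n), ρ.character (genA n ^ k * genB n) *
            (Module.finrank ℂ V : ℂ) ^ cycleCount (toPerm n (genA n ^ k * genB n))) := by
  rw [finrank_symmetryClass _ hρ, sum_SD, card_SD]
  simp only [cycleCount_genA_pow, Nat.cast_mul, Nat.cast_ofNat]

theorem finrank_symmetryClass_linearChar (hn : Even n) {x y : ℂˣ} (hx : x ^ 2 = 1)
    (hy : y ^ 2 = 1) {ε δ : ℝ} (hε : (x : ℂ) = ε) (hδ : (y : ℂ) = δ) :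
    (Module.finrank ℂ (symmetryClass (toPerm n) (fun g => linearChar n x y hx hy g) V) : ℝ) =
      1 / (8 * n) *
        (∑ k ∈ Finset.range (4 * n), ε ^ k * (Module.finrank ℂ V : ℝ) ^ Nat.gcd (4 * n) k +
          2 * n * δ * ((Module.finrank ℂ V : ℝ) ^ (2 * n + 1) +
            ε * (Module.finrank ℂ V : ℝ) ^ n)) := by
  have hpow (k : ℕ) : linearChar n x y hx hy (genA n ^ k) = x ^ k := by
    rw [map_pow, linearChar, lift_genA]
  have hpow_mul (k : ℕ) : linearChar n x y hx hy (genA n ^ k * genB n) = x ^ k * y := by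
    rw [map_mul, hpow, linearChar, lift_genB]
  have heven (i : ℕ) : x ^ (2 * i) = 1 := by rw [pow_mul, hx, one_pow]
  have hchar : (fun g => (linearChar n x y hx hy g : ℂ)) =
      (linearRep (linearChar n x y hx hy)).character :=
    funext fun g => (character_linearRep _ g).symm
  apply Complex.ofReal_injective
  rw [Complex.ofReal_natCast, hchar,
    finrank_symmetryClass_toPerm n V (finrank_intertwiningMap_linearRep _)]
  simp only [character_linearRep, hpow, hpow_mul, map_one]
  rw [sum_range_four_mul (fun k => ((x ^ k * y : ℂˣ) : ℂ) * _)]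
  simp only [cycleCount_genA_pow_mul_genB_of_even n hn (even_two_mul _),
    cycleCount_genA_pow_mul_genB_of_odd n (odd_two_mul_add_one _), pow_succ x, heven, one_mul,
    Finset.sum_const, Finset.card_range, nsmul_eq_mul]
  push_cast [hε, hδ]
  ring

theorem finrank_symmetryClass_rhoChar (hn : Even n) {h : ℕ} (hh : ¬ 2 * n ∣ h) :
    (Module.finrank ℂ (symmetryClass (toPerm n) (rhoChar n h) V) : ℂ) =
      1 / (4 * n) * ∑ k ∈ Finset.range (4 * n),
        rhoChar n h (genA n ^ k) * (Module.finrank ℂ V : ℂ) ^ Nat.gcd (4 * n) k := by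
  have hchar : rhoChar n h = (matrixRep (rho n h)).character :=
    funext fun g => (character_matrixRep _ g).symm
  have hirr := finrank_intertwiningMap_matrixRep (M := rho n h) (a := genA n ^ 1)
    (coe_rho_genA_pow n h 1) (coe_rho_genB n h) (by simpa using omega_pow_ne_omega_pow n hn hh)
  rw [hchar, finrank_symmetryClass_toPerm n V hirr, ← hchar, rhoChar_one]
  simp only [rhoChar_genA_pow_mul_genB, zero_mul, Finset.sum_const_zero, add_zero]
  ring

theorem finrank_symmetryClass_rhoChar_of_even (hn : Even n) {h : ℕ} (hh : Even h)
    (hh' : ¬ 2 * n ∣ h) :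
    (Module.finrank ℂ (symmetryClass (toPerm n) (rhoChar n h) V) : ℝ) =
      1 / (2 * n) * ∑ k ∈ Finset.range (4 * n),
        (Module.finrank ℂ V : ℝ) ^ Nat.gcd (4 * n) k * Real.cos (h * k * Real.pi / (2 * n)) := by
  apply Complex.ofReal_injective
  rw [Complex.ofReal_natCast, finrank_symmetryClass_rhoChar n V hn hh', Complex.ofReal_mul,
    Complex.ofReal_sum, Finset.mul_sum, Finset.mul_sum]
  refine Finset.sum_congr rfl fun k _ => ?_
  rw [rhoChar_genA_pow_of_even n (hh.mul_right k)]
  push_cast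
  ring

theorem sum_even_pow_gcd_mul_cos {h : ℕ} (hh : Odd h) (m : ℝ) :
    ∑ i ∈ Finset.range (2 * n),
        m ^ Nat.gcd (4 * n) (2 * i) * Real.cos (h * (2 * i : ℕ) * Real.pi / (2 * n)) =
      m ^ (4 * n) - m ^ (2 * n) + 2 * ∑ k ∈ CdagEven n,
        m ^ Nat.gcd (4 * n) k * Real.cos (h * k * Real.pi / (2 * n)) := by
  have hn : (n : ℝ) ≠ 0 := Nat.cast_ne_zero.2 (NeZero.ne n)
  have hsymm (k l : ℕ) (hkl : k + l = 4 * n) :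
      m ^ Nat.gcd (4 * n) k * Real.cos (h * k * Real.pi / (2 * n)) =
        m ^ Nat.gcd (4 * n) l * Real.cos (h * l * Real.pi / (2 * n)) := by
    have hangle : h * k * Real.pi / (2 * n) = h * (2 * Real.pi) - h * l * Real.pi / (2 * n) := by
      have hk : (k : ℝ) = 4 * n - l := eq_sub_of_add_eq (by exact_mod_cast hkl)
      rw [hk]
      field_simp
      ring
    rw [gcd_eq_gcd_of_add_eq hkl, hangle, Real.cos_nat_mul_two_pi_sub]
  have hcos : Real.cos (h * (2 * n : ℕ) * Real.pi / (2 * n)) = -1 := by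
    have hangle : h * (2 * n : ℕ) * Real.pi / (2 * n) = h * Real.pi := by
      push_cast
      field_simp
    rw [hangle, Real.cos_nat_mul_pi, hh.neg_one_pow]
  rw [sum_even_of_symm n hsymm, hcos, gcd_four_mul_two_mul, Nat.gcd_zero_right, Nat.cast_zero,
    mul_zero, zero_mul, zero_div, Real.cos_zero, nsmul_eq_mul, Nat.cast_ofNat]
  ring

theorem finrank_symmetryClass_rhoChar_of_odd (hn : Even n) {h : ℕ} (hh : Odd h) :
    (Module.finrank ℂ (symmetryClass (toPerm n) (rhoChar n h) V) : ℝ) =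
      1 / (4 * n) * (2 * (Module.finrank ℂ V : ℝ) ^ (4 * n) - 2 * (Module.finrank ℂ V : ℝ) ^ (2 * n)
        + 4 * ∑ k ∈ CdagEven n,
          (Module.finrank ℂ V : ℝ) ^ Nat.gcd (4 * n) k * Real.cos (h * k * Real.pi / (2 * n))) := by
  have hodd := sum_odd_of_antisymm (n := n)
    (f := fun k => rhoChar n h (genA n ^ k) * (Module.finrank ℂ V : ℂ) ^ Nat.gcd (4 * n) k)
    fun k l hk hkl => by
      rw [rhoChar_genA_pow_of_odd n hh hk hkl, gcd_eq_gcd_of_add_eq hkl, neg_mul]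
  have heven : ∑ i ∈ Finset.range (2 * n), rhoChar n h (genA n ^ (2 * i)) *
      (Module.finrank ℂ V : ℂ) ^ Nat.gcd (4 * n) (2 * i) =
      (2 * ∑ i ∈ Finset.range (2 * n), (Module.finrank ℂ V : ℝ) ^ Nat.gcd (4 * n) (2 * i) *
        Real.cos (h * (2 * i : ℕ) * Real.pi / (2 * n)) : ℝ) := by
    rw [Finset.mul_sum, Complex.ofReal_sum]
    refine Finset.sum_congr rfl fun i _ => ?_
    rw [rhoChar_genA_pow_of_even n ((even_two_mul i).mul_left h)]
    push_cast
    ring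
  apply Complex.ofReal_injective
  rw [Complex.ofReal_natCast, finrank_symmetryClass_rhoChar n V hn (not_two_mul_dvd_of_odd hh),
    sum_range_four_mul, hodd, heven, sum_even_pow_gcd_mul_cos n hh]
  push_cast
  ring

end Dimensions

end SemiDihedral

end

open SemiDihedral in
theorem theorem2p9_general (n : ℕ) [NeZero n] (hn : Even n)
    (V : Type*) [AddCommGroup V] [Module ℂ V] [FiniteDimensional ℂ V]
    (m : ℕ) (hm : Module.finrank ℂ V = m) :
    ((Module.finrank ℂ (symmetryClass (toPerm n) (chi0 n) V) : ℝ) =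
      1 / (8 * n) * (2 * n * (m : ℝ) ^ n + 2 * n * (m : ℝ) ^ (2 * n + 1)
        + ∑ k ∈ Finset.range (4 * n), (m : ℝ) ^ Nat.gcd (4 * n) k)) ∧
    ((Module.finrank ℂ (symmetryClass (toPerm n) (chi1 n) V) : ℝ) =
      1 / (8 * n) * (-(2 * n * (m : ℝ) ^ n) - 2 * n * (m : ℝ) ^ (2 * n + 1)
        + ∑ k ∈ Finset.range (4 * n), (m : ℝ) ^ Nat.gcd (4 * n) k)) ∧
    ((Module.finrank ℂ (symmetryClass (toPerm n) (chi2 n) V) : ℝ) =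
      1 / (8 * n) * ((m : ℝ) ^ (4 * n) + (m : ℝ) ^ (2 * n)
        + 2 * ∑ k ∈ CdagEven n, (m : ℝ) ^ Nat.gcd (4 * n) k
        - ∑ k ∈ CdagOdd n ∪ bar n (CdagOdd n), (m : ℝ) ^ Nat.gcd (4 * n) k
        + 2 * n * (m : ℝ) ^ (2 * n + 1) - 2 * n * (m : ℝ) ^ n)) ∧
    ((Module.finrank ℂ (symmetryClass (toPerm n) (chi3 n) V) : ℝ) =
      1 / (8 * n) * ((m : ℝ) ^ (4 * n) + (m : ℝ) ^ (2 * n)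
        + 2 * ∑ k ∈ CdagEven n, (m : ℝ) ^ Nat.gcd (4 * n) k
        - ∑ k ∈ CdagOdd n ∪ bar n (CdagOdd n), (m : ℝ) ^ Nat.gcd (4 * n) k
        - 2 * n * (m : ℝ) ^ (2 * n + 1) + 2 * n * (m : ℝ) ^ n)) ∧
    (∀ h, Even h → ¬ 2 * n ∣ h →
      (Module.finrank ℂ (symmetryClass (toPerm n) (rhoChar n h) V) : ℝ) =
      1 / (2 * n) * ∑ k ∈ Finset.range (4 * n),
        (m : ℝ) ^ Nat.gcd (4 * n) k * Real.cos (h * k * Real.pi / (2 * n))) ∧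
    (∀ h', Odd h' →
      (Module.finrank ℂ (symmetryClass (toPerm n) (rhoChar n h') V) : ℝ) =
      1 / (4 * n) * (2 * (m : ℝ) ^ (4 * n) - 2 * (m : ℝ) ^ (2 * n)
        + 4 * ∑ k ∈ CdagEven n,
            (m : ℝ) ^ Nat.gcd (4 * n) k * Real.cos (h' * k * Real.pi / (2 * n)))) := by
  subst hm
  refine ⟨?_, ?_, ?_, ?_, fun h => finrank_symmetryClass_rhoChar_of_even n V hn,
    fun h' => finrank_symmetryClass_rhoChar_of_odd n V hn⟩
  · refine (finrank_symmetryClass_linearChar n V hn (by simp) (by simp)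
      (x := 1) (y := 1) (ε := 1) (δ := 1) (by simp) (by simp)).trans ?_
    simp only [one_pow, one_mul]
    ring
  · refine (finrank_symmetryClass_linearChar n V hn (by simp) (by simp)
      (x := 1) (y := -1) (ε := 1) (δ := -1) (by simp) (by simp)).trans ?_
    simp only [one_pow, one_mul]
    ring
  · refine (finrank_symmetryClass_linearChar n V hn (by simp) (by simp)
      (x := -1) (y := 1) (ε := -1) (δ := 1) (by simp) (by simp)).trans ?_
    rw [sum_neg_one_pow_mul_pow_gcd hn]
    ring
  · refine (finrank_symmetryClass_linearChar n V hn (by simp) (by simp)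
      (x := -1) (y := -1) (ε := -1) (δ := -1) (by simp) (by simp)).trans ?_
    rw [sum_neg_one_pow_mul_pow_gcd hn]
    ring

theorem theorem2p9 (n : ℕ) [NeZero n] (hn : Even n)
    (V : Type*) [NormedAddCommGroup V] [InnerProductSpace ℂ V] [FiniteDimensional ℂ V]
    (m : ℕ) (hm : Module.finrank ℂ V = m) :
    ((Module.finrank ℂ
        (SemiDihedral.symmetryClass (SemiDihedral.toPerm n) (SemiDihedral.chi0 n) V) : ℝ) =
      1 / (8 * n) * (2 * n * (m : ℝ) ^ n + 2 * n * (m : ℝ) ^ (2 * n + 1)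
        + ∑ k ∈ Finset.range (4 * n), (m : ℝ) ^ Nat.gcd (4 * n) k)) ∧
    ((Module.finrank ℂ
        (SemiDihedral.symmetryClass (SemiDihedral.toPerm n) (SemiDihedral.chi1 n) V) : ℝ) =
      1 / (8 * n) * (-(2 * n * (m : ℝ) ^ n) - 2 * n * (m : ℝ) ^ (2 * n + 1)
        + ∑ k ∈ Finset.range (4 * n), (m : ℝ) ^ Nat.gcd (4 * n) k)) ∧
    ((Module.finrank ℂ
        (SemiDihedral.symmetryClass (SemiDihedral.toPerm n) (SemiDihedral.chi2 n) V) : ℝ) =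
      1 / (8 * n) * ((m : ℝ) ^ (4 * n) + (m : ℝ) ^ (2 * n)
        + 2 * ∑ k ∈ SemiDihedral.CdagEven n, (m : ℝ) ^ Nat.gcd (4 * n) k
        - ∑ k ∈ SemiDihedral.CdagOdd n ∪ SemiDihedral.bar n (SemiDihedral.CdagOdd n),
            (m : ℝ) ^ Nat.gcd (4 * n) k
        + 2 * n * (m : ℝ) ^ (2 * n + 1) - 2 * n * (m : ℝ) ^ n)) ∧
    ((Module.finrank ℂ
        (SemiDihedral.symmetryClass (SemiDihedral.toPerm n) (SemiDihedral.chi3 n) V) : ℝ) =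
      1 / (8 * n) * ((m : ℝ) ^ (4 * n) + (m : ℝ) ^ (2 * n)
        + 2 * ∑ k ∈ SemiDihedral.CdagEven n, (m : ℝ) ^ Nat.gcd (4 * n) k
        - ∑ k ∈ SemiDihedral.CdagOdd n ∪ SemiDihedral.bar n (SemiDihedral.CdagOdd n),
            (m : ℝ) ^ Nat.gcd (4 * n) k
        - 2 * n * (m : ℝ) ^ (2 * n + 1) + 2 * n * (m : ℝ) ^ n)) ∧
    (∀ h ∈ SemiDihedral.CdagEven n,
      (Module.finrank ℂ
        (SemiDihedral.symmetryClass (SemiDihedral.toPerm n) (SemiDihedral.rhoChar n h) V) : ℝ) =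
      1 / (2 * n) * ∑ k ∈ Finset.range (4 * n),
        (m : ℝ) ^ Nat.gcd (4 * n) k * Real.cos (h * k * Real.pi / (2 * n))) ∧
    (∀ h' ∈ SemiDihedral.CdagOdd n,
      (Module.finrank ℂ
        (SemiDihedral.symmetryClass (SemiDihedral.toPerm n) (SemiDihedral.rhoChar n h') V) : ℝ) =
      1 / (4 * n) * (2 * (m : ℝ) ^ (4 * n) - 2 * (m : ℝ) ^ (2 * n)
        + 4 * ∑ k ∈ SemiDihedral.CdagEven n,
            (m : ℝ) ^ Nat.gcd (4 * n) k * Real.cos (h' * k * Real.pi / (2 * n)))) := by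
  obtain ⟨h₀, h₁, h₂, h₃, h_even, h_odd⟩ := theorem2p9_general n hn V m hm
  exact ⟨h₀, h₁, h₂, h₃,
    fun h hh => h_even h ((SemiDihedral.mem_CdagEven n h).1 hh).1
      (SemiDihedral.not_two_mul_dvd_of_mem_CdagEven hh),
    fun h' hh' => h_odd h' ((SemiDihedral.mem_CdagOdd n h').1 hh').1⟩
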